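/- Let $\mathcal H$ be a finite-dimensional complex Hilbert space, $\hat H$ a self-adjoint operator on $\mathcal H$ with distinct eigenvalues $E_1,\dots,E_D$, and $\hat P_r$ the orthogonal projection onto the eigenspace of $E_r$. Let $\hat\rho_0$ be a density matrix (nonnegative definite, $\mathrm{tr}\,\hat\rho_0=1$), let $p_r=\mathrm{tr}\,\hat\rho_0\hat P_r$, and let $\hbar>0$ and $\sigma\in\mathbb R\setminus\{0\}$. On a probability space $(\Omega,\mathcal F,\mathbb P)$ let $\{B_t\}_{t\ge0}$ be a standard Brownian motion and $H$ an independent random variable with $\mathbb P[H=E_r]=p_r$ for $r=1,\dots,D$. Put $$\xi_t=\sigma tH+B_t,\qquad \hat K_t=\exp\!\left[-\tfrac{i}{\hbar}\hat Ht+\tfrac12\sigma\hat H\xi_t-\tfrac14\sigma^2\hat H^2t\right],\qquad \hat\rho_t=\frac{\hat K_t\hat\rho_0\hat K_t^*}{\mathrm{tr}[\hat K_t\hat\rho_0\hat K_t^*]},$$ and let $\mathbb F=\{\mathcal F_t\}$ be the filtration generated by $\{\xi_t\}$, or its usual augmentation (addition of the null events and right-continuous version), or any filtration between the two. Write $|\hat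 O|=(\mathrm{tr}\,\hat O\hat O^\dagger)^{1/2}$ and call a process $\{\pi_t\}_{t\geq 0}$ a potential if it is an almost surely strictly positive supermartingale with respect to $\mathbb F$, with almost surely right-continuous paths, such that $\lim_{t\to\infty}\mathbb E[\pi_t]=0$. Proposition. Let $n\neq m$ and $$\Phi_{nm,t}=\frac{\exp\left[\tfrac12\sigma(E_n+E_m)\xi_t-\tfrac14\sigma^2(E_n^2+E_m^2)t\right]}{\sum_{r=1}^Dp_r\exp\left[\sigma E_r\xi_t-\tfrac12\sigma^2E_r^2t\right]}.$$ If $\hat P_n\hat\rho_0\hat P_m\neq0$, then the norm $\{|\hat P_n\hat\rho_t\hat P_m|\}_{t\ge0}$ of the off-diagonal block is a potential. In all cases $|\hat P_n\hat\rho_t\hat P_m|=|\hat P_n\hat\rho_0\hat P_m|\,\Phi_{nm,t}$, the process $\{\Phi_{nm,t}\}_{t\ge0}$ is a potential, and for all $t\ge0$ $$\mathbb E[\Phi_{nm,t}]=\exp\left[-\tfrac18\sigma^2(E_n-E_m)^2t\right],\qquad \mathbb E\big[|\hat P_n\hat\rho_t\hat P_m|\big]=|\hat P_n\hat\rho_0\hat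 P_m|\exp\left[-\tfrac18\sigma^2(E_n-E_m)^2t\right].$$ -/

import Mathlib

open MeasureTheory ProbabilityTheory Filter Topology
open scoped NNReal

namespace EnergyReduction

noncomputable section

/-! ### Filtrations and potentials -/

/-- The usual augmentation of a filtration `𝓕` on `(Ω, mΩ, P)`: all `P`-null events are added to
every `𝓕 t`, and the right-continuous version `⋂_{u > t}` is taken. -/
def usualAugmentation {Ω : Type*} {mΩ : MeasurableSpace Ω} (𝓕 : Filtration ℝ≥0 mΩ)
    (P : Measure Ω) : Filtration ℝ≥0 mΩ :=
  Filtration.rightCont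
    { seq := fun t => 𝓕 t ⊔ MeasurableSpace.generateFrom {A | MeasurableSet A ∧ P A = 0}
      mono' := fun _ _ hst => sup_le_sup_right (𝓕.mono hst) _
      le' := fun t => sup_le (𝓕.le t) (MeasurableSpace.generateFrom_le fun _ hA => hA.1) }

/-- A potential on the filtered probability space `(Ω, mΩ, P, 𝔽)`: a strictly positive
supermartingale with (almost surely) right-continuous paths whose expectation tends to `0`. -/
structure IsPotential {Ω : Type*} {mΩ : MeasurableSpace Ω} (X : ℝ≥0 → Ω → ℝ)
    (𝔽 : Filtration ℝ≥0 mΩ) (P : Measure Ω) : Prop where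
  pos : ∀ᵐ ω ∂P, ∀ t, 0 < X t ω
  rightCts : ∀ᵐ ω ∂P, ∀ t, ContinuousWithinAt (fun s => X s ω) (Set.Ici t) t
  supermartingale : Supermartingale X 𝔽 P
  tendsto_expectation : Tendsto (fun t => ∫ ω, X t ω ∂P) atTop (𝓝 0)

/-! ### The information process -/

/-- The information process `ξ_t = σ t H + B_t`. -/
def infoProcess {Ω : Type*} (σ : ℝ) (H : Ω → ℝ) (B : ℝ≥0 → Ω → ℝ) (t : ℝ≥0) (ω : Ω) : ℝ :=
  σ * t * H ω + B t ω

theorem measurable_infoProcess {Ω : Type*} [MeasurableSpace Ω] (σ : ℝ) {H : Ω → ℝ}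
    {B : ℝ≥0 → Ω → ℝ} (hH : Measurable H) (hB : ∀ t, Measurable (B t)) (t : ℝ≥0) :
    Measurable (infoProcess σ H B t) :=
  (hH.const_mul (σ * t)).add (hB t)

/-- The filtration generated by the information process. -/
def infoFiltration {Ω : Type*} [mΩ : MeasurableSpace Ω] (σ : ℝ) {H : Ω → ℝ}
    {B : ℝ≥0 → Ω → ℝ} (hH : Measurable H) (hB : ∀ t, Measurable (B t)) : Filtration ℝ≥0 mΩ :=
  Filtration.natural (infoProcess σ H B)
    (fun t => (measurable_infoProcess σ hH hB t).stronglyMeasurable)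

/-! ### Operators on a finite-dimensional Hilbert space -/

section Operators

variable {𝓗 : Type*} [NormedAddCommGroup 𝓗] [InnerProductSpace ℂ 𝓗] [FiniteDimensional ℂ 𝓗]
  [CompleteSpace 𝓗]

/-- The trace of an operator. -/
def tr (A : 𝓗 →L[ℂ] 𝓗) : ℂ := LinearMap.trace ℂ 𝓗 (A : 𝓗 →ₗ[ℂ] 𝓗)

/-- The norm `|A| = (tr A A†)^{1/2}`. -/
def hsNorm (A : 𝓗 →L[ℂ] 𝓗) : ℝ := Real.sqrt (tr (A * star A)).re

/-- The orthogonal projection onto the eigenspace of `Hhat` with eigenvalue `E`. -/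
def energyProj (Hhat : 𝓗 →L[ℂ] 𝓗) (E : ℝ) : 𝓗 →L[ℂ] 𝓗 :=
  (Module.End.eigenspace (Hhat : 𝓗 →ₗ[ℂ] 𝓗) (E : ℂ)).starProjection

/-- The operator `exp [-i ħ⁻¹ Ĥ t + ½ σ Ĥ x - ¼ σ² Ĥ² t]`, where `x` is the value of the
information process at time `t`. -/
def propagator (hbar σ : ℝ) (Hhat : 𝓗 →L[ℂ] 𝓗) (t x : ℝ) : 𝓗 →L[ℂ] 𝓗 :=
  NormedSpace.exp
    ((-Complex.I * ((hbar⁻¹ * t : ℝ) : ℂ)) • Hhat + ((1 / 2 * σ * x : ℝ) : ℂ) • Hhat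
      - ((1 / 4 * σ ^ 2 * t : ℝ) : ℂ) • Hhat ^ 2)

/-- The state `ρ_t = K_t ρ₀ K_t* / tr [K_t ρ₀ K_t*]`, where `x` is the value of the information
process at time `t`. -/
def stateAt (hbar σ : ℝ) (Hhat ρ₀ : 𝓗 →L[ℂ] 𝓗) (t x : ℝ) : 𝓗 →L[ℂ] 𝓗 :=
  (tr (propagator hbar σ Hhat t x * ρ₀ * star (propagator hbar σ Hhat t x)))⁻¹ •
    (propagator hbar σ Hhat t x * ρ₀ * star (propagator hbar σ Hhat t x))

/-- The process `Φ_{nm,t}` as a function of the time `t` and of the value `x` of the information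
process at time `t`; `E 0, …, E (D - 1)` are the energy levels and `p r = tr ρ₀ P_r`. -/
def decoherenceFactor {D : ℕ} (σ : ℝ) (E p : Fin D → ℝ) (n m : Fin D) (t x : ℝ) : ℝ :=
  Real.exp (1 / 2 * σ * (E n + E m) * x - 1 / 4 * σ ^ 2 * (E n ^ 2 + E m ^ 2) * t) /
    ∑ r, p r * Real.exp (σ * E r * x - 1 / 2 * σ ^ 2 * E r ^ 2 * t)

end Operators

end

end EnergyReduction

namespace EnergyReduction

/-! ### Exponentials acting on eigenvectors in a Banach algebra -/

section Exponential

variable {𝔸 : Type*} [NormedRing 𝔸] [NormedAlgebra ℂ 𝔸] [CompleteSpace 𝔸]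

/-! On an energy eigenspace the propagator is a scalar, so the block between `E n` and `E m` is only
rescaled. The phases have modulus one, and the normalising trace is the mixture `L_t(ξ_t)`, the
denominator of `Φ`. This gives the norm identity.

For the probabilistic part, conditioning on `H` and Cameron-Martin (`lintegral_path_infoProcess`)
show that the law of `ξ` on `[0, T]` has density `L_T(B_T)` relative to Brownian motion. This
density cancels the denominator of `Φ_T`, leaving the numerator evaluated along `B`. The numerator
is `exp(-κ T)`, with `κ = σ² (E n - E m)² / 8`, times an exponential martingale. Hence `E[Φ_T; A] =
exp(-κ (T - s)) E[Φ_s; A]` for `A` in the unaugmented filtration at time `s`, which gives the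
expectation and its decay.

For an augmented filtration, `A` is a.e. equal to an event known at any `u > s`. The inequality at
`u` is carried to `s` by path continuity and Fatou's lemma. -/

theorem exp_mul_of_mul_eq_smul {a p : 𝔸} {c : ℂ} (h : a * p = c • p) :
    NormedSpace.exp a * p = Complex.exp c • p := by
  have hpow : ∀ k : ℕ, a ^ k * p = c ^ k • p := by
    intro k
    induction k with
    | zero => simp
    | succ k ih => rw [pow_succ, mul_assoc, h, mul_smul_comm, ih, smul_smul, pow_succ']
  have h₁ := (NormedSpace.exp_series_hasSum_exp' (𝕂 := ℂ) a).mul_right p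
  have h₂ := (NormedSpace.exp_series_hasSum_exp' (𝕂 := ℂ) c).smul_const p
  rw [Complex.exp_eq_exp_ℂ]
  refine h₁.unique (h₂.congr_fun ?_)
  intro k
  simp [hpow, smul_smul]

end Exponential

/-! ### Traces, spectral projections and the reduced off-diagonal block -/

section Operators

variable {𝓗 : Type*} [NormedAddCommGroup 𝓗] [InnerProductSpace ℂ 𝓗]

theorem tr_mul_comm (A B : 𝓗 →L[ℂ] 𝓗) : tr (A * B) = tr (B * A) :=
  LinearMap.trace_mul_comm ℂ (A : 𝓗 →ₗ[ℂ] 𝓗) (B : 𝓗 →ₗ[ℂ] 𝓗)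

theorem tr_smul (c : ℂ) (A : 𝓗 →L[ℂ] 𝓗) : tr (c • A) = c * tr A := by
  simp [tr]

theorem tr_sum {ι : Type*} (s : Finset ι) (A : ι → 𝓗 →L[ℂ] 𝓗) :
    tr (∑ i ∈ s, A i) = ∑ i ∈ s, tr (A i) := by
  simp [tr]

variable [CompleteSpace 𝓗] {Hhat : 𝓗 →L[ℂ] 𝓗}

theorem star_energyProj (E : ℝ) : star (energyProj Hhat E) = energyProj Hhat E :=
  isSelfAdjoint_starProjection _

theorem mul_energyProj (E : ℝ) : Hhat * energyProj Hhat E = (E : ℂ) • energyProj Hhat E := by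
  ext x
  exact Module.End.mem_eigenspace_iff.1
    (Submodule.starProjection_apply_mem
      (Module.End.eigenspace (Hhat : 𝓗 →ₗ[ℂ] 𝓗) (E : ℂ)) x)

/-- Evaluating the trace in an orthonormal basis makes `hsNorm` visibly definite. -/
theorem tr_mul_star_self [FiniteDimensional ℂ 𝓗] (A : 𝓗 →L[ℂ] 𝓗) :
    tr (A * star A)
      = ((∑ i, ‖star A (stdOrthonormalBasis ℂ 𝓗 i)‖ ^ 2 : ℝ) : ℂ) := by
  rw [tr, LinearMap.trace_eq_sum_inner _ (stdOrthonormalBasis ℂ 𝓗), Complex.ofReal_sum]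
  refine Finset.sum_congr rfl fun i _ => ?_
  have : inner ℂ (stdOrthonormalBasis ℂ 𝓗 i) (A (star A (stdOrthonormalBasis ℂ 𝓗 i)))
      = inner ℂ (star A (stdOrthonormalBasis ℂ 𝓗 i)) (star A (stdOrthonormalBasis ℂ 𝓗 i)) :=
    (ContinuousLinearMap.adjoint_inner_left A _ _).symm
  rw [inner_self_eq_norm_sq_to_K] at this
  simpa using this

theorem hsNorm_smul (c : ℂ) (A : 𝓗 →L[ℂ] 𝓗) : hsNorm (c • A) = ‖c‖ * hsNorm A := by
  have h : tr (c • A * star (c • A)) = ((‖c‖ ^ 2 : ℝ) : ℂ) * tr (A * star A) := by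
    rw [star_smul, smul_mul_smul_comm, tr_smul]
    congr 1
    rw [Complex.star_def, Complex.mul_conj, Complex.normSq_eq_norm_sq]
  rw [hsNorm, hsNorm, h, Complex.re_ofReal_mul, Real.sqrt_mul (sq_nonneg _),
    Real.sqrt_sq (norm_nonneg _)]

theorem hsNorm_pos [FiniteDimensional ℂ 𝓗] {A : 𝓗 →L[ℂ] 𝓗} (hA : A ≠ 0) : 0 < hsNorm A := by
  rw [hsNorm, tr_mul_star_self, Complex.ofReal_re, Real.sqrt_pos]
  refine lt_of_le_of_ne (by positivity) fun h => hA ?_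
  have h0 := (Finset.sum_eq_zero_iff_of_nonneg fun i _ => by positivity).1 h.symm
  have : star A = 0 := by
    apply ContinuousLinearMap.coe_injective
    refine (stdOrthonormalBasis ℂ 𝓗).toBasis.ext fun i => ?_
    simpa using h0 i (Finset.mem_univ i)
  simpa using this

/-- Spectral theorem: the eigenspaces of a symmetric operator are orthogonal and span, and those not
listed by `E` are trivial. -/
theorem sum_energyProj [FiniteDimensional ℂ 𝓗] (hHhat : IsSelfAdjoint Hhat) {D : ℕ} {E : Fin D → ℝ}
    (hE_inj : Function.Injective E)
    (hE_spec : ∀ z : ℂ,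
      Module.End.HasEigenvalue (Hhat : 𝓗 →ₗ[ℂ] 𝓗) z ↔ ∃ r, z = (E r : ℂ)) :
    ∑ r, energyProj Hhat (E r) = 1 := by
  have hsym : (Hhat : 𝓗 →ₗ[ℂ] 𝓗).IsSymmetric := hHhat.isSymmetric
  have hfam := hsym.orthogonalFamily_eigenspaces.comp
    (γ := Fin D) (f := fun r => (E r : ℂ)) fun i j h => hE_inj (by simpa using h)
  have htop : ⨆ r, Module.End.eigenspace (Hhat : 𝓗 →ₗ[ℂ] 𝓗) (E r : ℂ) = ⊤ := by
    have h := Submodule.orthogonal_eq_bot_iff.1 hsym.orthogonalComplement_iSup_eigenspaces_eq_bot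
    rw [eq_top_iff, ← h]
    refine iSup_le fun z => ?_
    by_cases hz : Module.End.HasEigenvalue (Hhat : 𝓗 →ₗ[ℂ] 𝓗) z
    · obtain ⟨r, rfl⟩ := (hE_spec z).1 hz
      exact le_iSup (fun r => Module.End.eigenspace (Hhat : 𝓗 →ₗ[ℂ] 𝓗) (E r : ℂ)) r
    · rw [Module.End.hasEigenvalue_iff, not_not] at hz
      simp [hz]
  ext x
  simpa [energyProj] using hfam.sum_projection_of_mem_iSup x (by rw [htop]; trivial)

/-- The exponent of the eigenvalue of the propagator on the eigenspace of the energy `E`. -/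
noncomputable def propagatorExponent (hbar σ E t x : ℝ) : ℂ :=
  -Complex.I * ((hbar⁻¹ * t : ℝ) : ℂ) * E + ((1 / 2 * σ * x : ℝ) : ℂ) * E
    - ((1 / 4 * σ ^ 2 * t : ℝ) : ℂ) * (E : ℂ) ^ 2

/-- The `hbar` term is purely imaginary and contributes only a phase. -/
theorem norm_exp_propagatorExponent (hbar σ E t x : ℝ) :
    ‖Complex.exp (propagatorExponent hbar σ E t x)‖
      = Real.exp (1 / 2 * σ * E * x - 1 / 4 * σ ^ 2 * E ^ 2 * t) := by
  have : propagatorExponent hbar σ E t x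
      = ((1 / 2 * σ * E * x - 1 / 4 * σ ^ 2 * E ^ 2 * t : ℝ) : ℂ)
        + ((-(hbar⁻¹ * t * E) : ℝ) : ℂ) * Complex.I := by
    rw [propagatorExponent]
    push_cast
    ring
  rw [Complex.norm_exp, this]
  simp [-Complex.ofReal_neg, -Complex.ofReal_mul, -Complex.ofReal_sub]

theorem propagator_mul_energyProj (hbar σ E t x : ℝ) :
    propagator hbar σ Hhat t x * energyProj Hhat E
      = Complex.exp (propagatorExponent hbar σ E t x) • energyProj Hhat E := by
  refine exp_mul_of_mul_eq_smul ?_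
  have hsq : Hhat ^ 2 * energyProj Hhat E = ((E : ℂ) ^ 2) • energyProj Hhat E := by
    rw [pow_two, mul_assoc, mul_energyProj, mul_smul_comm, mul_energyProj, smul_smul, pow_two]
  rw [sub_mul, add_mul, smul_mul_assoc, smul_mul_assoc, smul_mul_assoc, mul_energyProj, hsq,
    smul_smul, smul_smul, smul_smul, ← add_smul, ← sub_smul]
  rfl

theorem commute_energyProj (hHhat : IsSelfAdjoint Hhat) (E : ℝ) :
    Commute Hhat (energyProj Hhat E) := by
  have h := congrArg star (mul_energyProj (Hhat := Hhat) E)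
  rw [star_mul, star_smul, star_energyProj, hHhat.star_eq, Complex.star_def,
    Complex.conj_ofReal, ← mul_energyProj] at h
  exact h.symm

theorem commute_propagator_energyProj (hHhat : IsSelfAdjoint Hhat) (hbar σ E t x : ℝ) :
    Commute (propagator hbar σ Hhat t x) (energyProj Hhat E) := by
  have h := commute_energyProj hHhat E
  exact (((h.smul_left _).add_left (h.smul_left _)).sub_left
    ((h.pow_left 2).smul_left _)).exp_left

theorem energyProj_mul_star_propagator (hHhat : IsSelfAdjoint Hhat) (hbar σ E t x : ℝ) :
    star (propagator hbar σ Hhat t x) * energyProj Hhat E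
      = star (Complex.exp (propagatorExponent hbar σ E t x)) • energyProj Hhat E := by
  rw [← star_energyProj (Hhat := Hhat), ← star_mul, ← star_smul,
    ← propagator_mul_energyProj, (commute_propagator_energyProj hHhat hbar σ E t x).eq]

/-- The projections commute with the propagator, so each meets its own factor and turns it into a
scalar. -/
theorem energyProj_mul_conj_propagator_mul_energyProj (hHhat : IsSelfAdjoint Hhat)
    (ρ₀ : 𝓗 →L[ℂ] 𝓗) (hbar σ E E' t x : ℝ) :
    energyProj Hhat E * (propagator hbar σ Hhat t x * ρ₀ * star (propagator hbar σ Hhat t x))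
        * energyProj Hhat E'
      = (Complex.exp (propagatorExponent hbar σ E t x)
          * star (Complex.exp (propagatorExponent hbar σ E' t x))) •
        (energyProj Hhat E * ρ₀ * energyProj Hhat E') := by
  have h := (commute_propagator_energyProj hHhat hbar σ E t x).eq
  rw [propagator_mul_energyProj] at h
  calc _ = (energyProj Hhat E * propagator hbar σ Hhat t x) * ρ₀
        * (star (propagator hbar σ Hhat t x) * energyProj Hhat E') := by simp only [mul_assoc]
    _ = _ := by
      rw [← h, energyProj_mul_star_propagator hHhat, smul_mul_assoc, smul_mul_smul_comm]

theorem tr_star [FiniteDimensional ℂ 𝓗] (A : 𝓗 →L[ℂ] 𝓗) : tr (star A) = star (tr A) := by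
  rw [tr, tr, LinearMap.trace_eq_sum_inner _ (stdOrthonormalBasis ℂ 𝓗),
    LinearMap.trace_eq_sum_inner _ (stdOrthonormalBasis ℂ 𝓗), star_sum]
  refine Finset.sum_congr rfl fun i _ => ?_
  exact (ContinuousLinearMap.adjoint_inner_right A _ _).trans (inner_conj_symm _ _).symm

/-- Adjunction and cyclicity make this trace its own conjugate. -/
theorem tr_mul_energyProj [FiniteDimensional ℂ 𝓗] {ρ₀ : 𝓗 →L[ℂ] 𝓗}
    (hρ₀ : IsSelfAdjoint ρ₀) (E : ℝ) :
    tr (ρ₀ * energyProj Hhat E) = ((tr (ρ₀ * energyProj Hhat E)).re : ℂ) := by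
  refine (Complex.conj_eq_iff_re.1 ?_).symm
  rw [← Complex.star_def, ← tr_star, star_mul, star_energyProj, hρ₀.star_eq, tr_mul_comm]

/-- The density of the law of the information process with respect to the Wiener measure. -/
noncomputable def mixtureLikelihood {D : ℕ} (σ : ℝ) (E p : Fin D → ℝ) (t x : ℝ) : ℝ :=
  ∑ r, p r * Real.exp (σ * E r * x - 1 / 2 * σ ^ 2 * E r ^ 2 * t)

/-- By cyclicity only `star K * K` matters. It is diagonal in the energy projections, with the
phases cancelled. -/
theorem tr_conj_propagator [FiniteDimensional ℂ 𝓗] (hHhat : IsSelfAdjoint Hhat) {ρ₀ : 𝓗 →L[ℂ] 𝓗}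
    (hρ₀ : IsSelfAdjoint ρ₀) {D : ℕ} {E : Fin D → ℝ} (hsum : ∑ r, energyProj Hhat (E r) = 1)
    (hbar σ t x : ℝ) :
    tr (propagator hbar σ Hhat t x * ρ₀ * star (propagator hbar σ Hhat t x))
      = (mixtureLikelihood σ E (fun r => (tr (ρ₀ * energyProj Hhat (E r))).re) t x : ℂ) := by
  set K := propagator hbar σ Hhat t x
  have hK : ∀ r, star K * K * energyProj Hhat (E r)
      = (Real.exp (σ * E r * x - 1 / 2 * σ ^ 2 * E r ^ 2 * t) : ℂ) • energyProj Hhat (E r) := by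
    intro r
    rw [mul_assoc, propagator_mul_energyProj, mul_smul_comm,
      energyProj_mul_star_propagator hHhat, smul_smul]
    congr 1
    rw [Complex.star_def, Complex.mul_conj, Complex.normSq_eq_norm_sq,
      norm_exp_propagatorExponent, ← Real.exp_nat_mul]
    congr 2
    push_cast
    ring
  have hKK : star K * K = ∑ r,
      (Real.exp (σ * E r * x - 1 / 2 * σ ^ 2 * E r ^ 2 * t) : ℂ) • energyProj Hhat (E r) := by
    rw [← Finset.sum_congr rfl fun r _ => hK r, ← Finset.mul_sum, hsum, mul_one]
  rw [mul_assoc, tr_mul_comm, mul_assoc, hKK, Finset.mul_sum, tr_sum, mixtureLikelihood,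
    Complex.ofReal_sum]
  refine Finset.sum_congr rfl fun r _ => ?_
  rw [mul_smul_comm, tr_smul, tr_mul_energyProj hρ₀, mul_comm]
  push_cast
  rfl

theorem sum_tr_mul_energyProj {ρ₀ : 𝓗 →L[ℂ] 𝓗} (hρ₀_tr : tr ρ₀ = 1) {D : ℕ} {E : Fin D → ℝ}
    (hsum : ∑ r, energyProj Hhat (E r) = 1) :
    ∑ r, (tr (ρ₀ * energyProj Hhat (E r))).re = 1 := by
  rw [← Complex.re_sum, ← tr_sum, ← Finset.mul_sum, hsum, mul_one, hρ₀_tr, Complex.one_re]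

theorem hsNorm_energyProj_mul_stateAt_mul_energyProj [FiniteDimensional ℂ 𝓗]
    (hHhat : IsSelfAdjoint Hhat) {ρ₀ : 𝓗 →L[ℂ] 𝓗} (hρ₀ : IsSelfAdjoint ρ₀) {D : ℕ} {E : Fin D → ℝ}
    (hsum : ∑ r, energyProj Hhat (E r) = 1) (hbar σ : ℝ) (n m : Fin D) (t x : ℝ)
    (hL : 0 < mixtureLikelihood σ E (fun r => (tr (ρ₀ * energyProj Hhat (E r))).re) t x) :
    hsNorm (energyProj Hhat (E n) * stateAt hbar σ Hhat ρ₀ t x * energyProj Hhat (E m))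
      = hsNorm (energyProj Hhat (E n) * ρ₀ * energyProj Hhat (E m))
        * decoherenceFactor σ E (fun r => (tr (ρ₀ * energyProj Hhat (E r))).re) n m t x := by
  rw [stateAt, mul_smul_comm, smul_mul_assoc,
    energyProj_mul_conj_propagator_mul_energyProj hHhat, smul_smul, hsNorm_smul, norm_mul,
    norm_mul, norm_star, norm_exp_propagatorExponent, norm_exp_propagatorExponent, norm_inv,
    tr_conj_propagator hHhat hρ₀ hsum, Complex.norm_real, Real.norm_of_nonneg hL.le,
    ← Real.exp_add, decoherenceFactor, ← mixtureLikelihood, mul_comm]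
  congr 1
  rw [mul_comm (mixtureLikelihood _ _ _ _ _)⁻¹, ← div_eq_mul_inv]
  congr 2
  ring

end Operators

/-! ### Gaussian shifts and the Cameron-Martin formula -/

section CameronMartin

open scoped ENNReal

/-- Completing the square in the density; for `v = 0` the measure is a Dirac mass at `0` and nothing
is shifted. -/
theorem lintegral_gaussianReal_add_mul_var (v : ℝ≥0) (c : ℝ) {f : ℝ → ℝ≥0∞}
    (hf : Measurable f) :
    ∫⁻ x, f (x + c * v) ∂gaussianReal 0 v
      = ∫⁻ x, f x * ENNReal.ofReal (Real.exp (c * x - c ^ 2 * v / 2)) ∂gaussianReal 0 v := by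
  rcases eq_or_ne v 0 with rfl | hv
  · simp
  rw [← lintegral_map hf (measurable_add_const (c * v)), gaussianReal_map_add_const, zero_add,
    gaussianReal_of_var_ne_zero _ hv, gaussianReal_of_var_ne_zero _ hv,
    lintegral_withDensity_eq_lintegral_mul _ (measurable_gaussianPDF _ _) hf,
    lintegral_withDensity_eq_lintegral_mul _ (measurable_gaussianPDF _ _)
      (by fun_prop)]
  refine lintegral_congr fun x => ?_
  simp only [Pi.mul_apply, gaussianPDF]
  rw [mul_comm (f x), ← mul_assoc, ← ENNReal.ofReal_mul (gaussianPDFReal_nonneg _ _ _), gaussianPDFReal, gaussianPDFReal,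
    mul_assoc (√_)⁻¹, ← Real.exp_add]
  congr 5
  have : (v : ℝ) ≠ 0 := by exact_mod_cast hv
  field_simp
  ring

theorem lintegral_exp_gaussianReal (v : ℝ≥0) (c : ℝ) :
    ∫⁻ x, ENNReal.ofReal (Real.exp (c * x - c ^ 2 * v / 2)) ∂gaussianReal 0 v = 1 := by
  simpa using (lintegral_gaussianReal_add_mul_var v c (f := fun _ => 1) measurable_const).symm

variable {Ω : Type*} [mΩ : MeasurableSpace Ω] {P : Measure Ω} [IsProbabilityMeasure P]
  {B : ℝ≥0 → Ω → ℝ}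

/-- The value of a Brownian motion at time `T` is independent of its Brownian bridge on `[0, T]`. -/
theorem indepFun_eval_bridge (hB : IsPreBrownianReal B P) (T : ℝ≥0) :
    IndepFun (B T) (fun ω (u : Set.Iic T) => B u ω - (u / T : ℝ) * B T ω) P := by
  have h : IndepFun (fun ω (_ : Unit) => B T ω)
      (fun ω (u : Set.Iic T) => B u ω - (u / T : ℝ) * B T ω) P := by
    have hmeas : ∀ t, AEMeasurable (B t) P := hB.aemeasurable
    have hL2 : ∀ t, MemLp (B t) 2 P := fun t =>
      (hB.isGaussianProcess.hasGaussianLaw_eval t).memLp_two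
    -- Jointly Gaussian and uncorrelated: `cov(B_T, B_u - (u/T) B_T) = u - (u/T) T = 0`.
    refine IsGaussianProcess.indepFun_of_covariance_eq_zero
      (X := fun (_ : Unit) ω => B T ω)
      (Y := fun (u : Set.Iic T) ω => B u ω - (u / T : ℝ) * B T ω) ?_ (fun _ => hmeas T)
      (fun u => (hmeas u).sub ((hmeas T).const_mul _)) ?_
    · refine hB.isGaussianProcess.of_isGaussianProcess ?_
      rintro (_ | ⟨u, hu⟩)
      · exact ⟨{T}, ContinuousLinearMap.proj ⟨T, by simp⟩, by simp⟩
      · refine ⟨{u, T}, ContinuousLinearMap.proj ⟨u, by simp⟩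
          - (u / T : ℝ) • ContinuousLinearMap.proj ⟨T, by simp⟩, by simp⟩
    · rintro _ ⟨u, hu : u ≤ T⟩
      rw [covariance_fun_sub_right (hL2 T) (hL2 u) ((hL2 T).const_mul _),
        covariance_const_mul_right, hB.covariance_eval, hB.covariance_fun_eval, min_self,
        min_eq_right hu]
      -- At `T = 0` the quotient `u / T` is `0` by convention, and `u = 0` as well.
      rcases eq_or_ne T 0 with rfl | hT
      · simp [nonpos_iff_eq_zero.1 hu]
      · have : (T : ℝ) ≠ 0 := by exact_mod_cast hT
        field_simp
        simp
  exact h.comp (φ := fun x : Unit → ℝ => x ()) (ψ := id) (measurable_pi_apply _) measurable_id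

/-- The Cameron-Martin formula for a Brownian motion with constant drift on `[0, T]`. -/
theorem lintegral_path_add_drift (hB_meas : ∀ t, Measurable (B t)) (hB : IsPreBrownianReal B P)
    (T : ℝ≥0) (c : ℝ) {F : (Set.Iic T → ℝ) → ℝ≥0∞} (hF : Measurable F) :
    ∫⁻ ω, F (fun u => B u ω + c * u) ∂P
      = ∫⁻ ω, F (fun u => B u ω)
          * ENNReal.ofReal (Real.exp (c * B T ω - c ^ 2 * T / 2)) ∂P := by
  -- A linear drift leaves the bridge `Z` unchanged and only moves the endpoint by `c * T`. As `Z`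
  -- is independent of `B T`, the formula reduces to a one-dimensional Gaussian shift with `Z`
  -- fixed.
  set Z : Ω → Set.Iic T → ℝ := fun ω u => B u ω - (u / T : ℝ) * B T ω with hZ
  have hZ_meas : Measurable Z :=
    measurable_pi_lambda _ fun u => (hB_meas u).sub ((hB_meas T).const_mul _)
  set G : ℝ × (Set.Iic T → ℝ) → ℝ≥0∞ := fun q => F (fun u => q.2 u + (u / T : ℝ) * q.1) with hG
  have hG_meas : Measurable G := hF.comp <| measurable_pi_lambda _ fun u =>
    ((measurable_pi_apply u).comp measurable_snd).add (measurable_fst.const_mul _)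
  have hlaw : P.map (fun ω => (B T ω, Z ω)) = (gaussianReal 0 T).prod (P.map Z) := by
    rw [(indepFun_iff_map_prod_eq_prod_map_map (hB_meas T).aemeasurable
      hZ_meas.aemeasurable).1 (indepFun_eval_bridge hB T), (hB.hasLaw_eval T).map_eq]
  have hpair : Measurable fun ω => (B T ω, Z ω) := (hB_meas T).prodMk hZ_meas
  have hleft : ∀ ω, F (fun u => B u ω + c * u) = G (B T ω + c * T, Z ω) := by
    intro ω
    simp only [hG, hZ]
    congr 1
    funext ⟨u, hu⟩
    rcases eq_or_ne T 0 with rfl | hT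
    · have : u = 0 := nonpos_iff_eq_zero.1 hu
      simp [this]
    · have : (T : ℝ) ≠ 0 := by exact_mod_cast hT
      field_simp
      ring
  have hright : ∀ ω, F (fun u => B u ω) = G (B T ω, Z ω) := by
    intro ω
    simp [hG, hZ]
  have : IsProbabilityMeasure (P.map Z) := Measure.isProbabilityMeasure_map hZ_meas.aemeasurable
  calc ∫⁻ ω, F (fun u => B u ω + c * u) ∂P
      = ∫⁻ q, G (q.1 + c * T, q.2) ∂P.map (fun ω => (B T ω, Z ω)) := by
        rw [lintegral_map (by fun_prop) hpair]
        exact lintegral_congr hleft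
    _ = ∫⁻ z, ∫⁻ y, G (y + c * T, z) ∂gaussianReal 0 T ∂P.map Z := by
        rw [hlaw, lintegral_prod_symm _ (by fun_prop)]
    _ = ∫⁻ z, ∫⁻ y, G (y, z) * ENNReal.ofReal (Real.exp (c * y - c ^ 2 * T / 2))
          ∂gaussianReal 0 T ∂P.map Z :=
        lintegral_congr fun z =>
          lintegral_gaussianReal_add_mul_var T c (f := fun y => G (y, z)) (by fun_prop)
    _ = ∫⁻ q, G q * ENNReal.ofReal (Real.exp (c * q.1 - c ^ 2 * T / 2))
          ∂P.map (fun ω => (B T ω, Z ω)) := by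
        rw [hlaw, lintegral_prod_symm _ (by fun_prop)]
    _ = _ := by
        rw [lintegral_map (by fun_prop) hpair]
        exact lintegral_congr fun ω => by rw [hright]

end CameronMartin

/-! ### The law of the information process as a mixture of drifted Brownian laws -/

section Mixture

open scoped ENNReal

variable {Ω : Type*} [mΩ : MeasurableSpace Ω] {P : Measure Ω} [IsProbabilityMeasure P]
  {B : ℝ≥0 → Ω → ℝ} {H : Ω → ℝ} {D : ℕ} {E p : Fin D → ℝ}

theorem mixtureLikelihood_pos (σ : ℝ) (hp : ∀ r, 0 ≤ p r) (hp_sum : ∑ r, p r = 1) (t x : ℝ) :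
    0 < mixtureLikelihood σ E p t x := by
  obtain ⟨r, -, hr⟩ : ∃ r ∈ Finset.univ, 0 < p r := by
    by_contra! h
    linarith [Finset.sum_nonpos h]
  exact Finset.sum_pos' (fun i _ => mul_nonneg (hp i) (Real.exp_pos _).le)
    ⟨r, Finset.mem_univ _, mul_pos hr (Real.exp_pos _)⟩

theorem measurable_mixtureLikelihood (σ t : ℝ) :
    Measurable (mixtureLikelihood σ E p t) := by
  unfold mixtureLikelihood
  fun_prop

/-- The law of the information process on `[0, T]` has the density `mixtureLikelihood` with respect
to the law of the Brownian motion. -/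
theorem lintegral_path_infoProcess (σ : ℝ) (hB_meas : ∀ t, Measurable (B t))
    (hB : IsPreBrownianReal B P) (hH_meas : Measurable H) (hE_inj : Function.Injective E)
    (hH_law : ∀ r, P.real {ω | H ω = E r} = p r) (hp_sum : ∑ r, p r = 1)
    (hHB : IndepFun H (fun ω t => B t ω) P) (T : ℝ≥0)
    {F : (Set.Iic T → ℝ) → ℝ≥0∞} (hF : Measurable F) :
    ∫⁻ ω, F (fun u => infoProcess σ H B u ω) ∂P
      = ∫⁻ ω, F (fun u => B u ω) * ENNReal.ofReal (mixtureLikelihood σ E p T (B T ω)) ∂P := by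
  have hA_meas : ∀ r, MeasurableSet {ω | H ω = E r} := fun r =>
    hH_meas (measurableSet_singleton (E r))
  have hA_disj : Pairwise (Function.onFun Disjoint fun r => {ω | H ω = E r}) := by
    intro r r' hrr'
    rw [Function.onFun, Set.disjoint_left]
    intro ω h h'
    exact hrr' (hE_inj (h.symm.trans h'))
  have hp : ∀ r, 0 ≤ p r := fun r => hH_law r ▸ measureReal_nonneg
  have hPA : ∀ r, P {ω | H ω = E r} = ENNReal.ofReal (p r) := fun r => by
    rw [← hH_law r, ofReal_measureReal]
  -- `H` takes its values among the levels almost surely because the `p r` already sum to one.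
  have hcover : (⋃ r, {ω | H ω = E r}) =ᵐ[P] Set.univ := by
    rw [eventuallyEq_univ, mem_ae_iff, prob_compl_eq_zero_iff (.iUnion hA_meas),
      measure_iUnion hA_disj hA_meas, tsum_fintype, Finset.sum_congr rfl fun r _ => hPA r,
      ← ENNReal.ofReal_sum_of_nonneg fun r _ => hp r, hp_sum, ENNReal.ofReal_one]
  have hB_path : Measurable fun ω (u : Set.Iic T) => B u ω :=
    measurable_pi_lambda _ fun u => hB_meas u
  -- On `H = E r` the path is `B` with drift `σ * E r`; independence factors out `p r`.
  have hpiece : ∀ r, ∫⁻ ω in {ω | H ω = E r}, F (fun u => infoProcess σ H B u ω) ∂P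
      = ∫⁻ ω, ENNReal.ofReal (p r) * (F (fun u => B u ω)
          * ENNReal.ofReal (Real.exp (σ * E r * B T ω - (σ * E r) ^ 2 * T / 2))) ∂P := by
    intro r
    have hdrift : Measurable fun x : ℝ≥0 → ℝ =>
        F (fun u : Set.Iic T => x u + σ * E r * u) := by
      refine hF.comp (measurable_pi_lambda _ fun u => ?_)
      exact (measurable_pi_apply _).add_const _
    have hind := hHB.comp (φ := ({E r} : Set ℝ).indicator (1 : ℝ → ℝ≥0∞))
      (measurable_one.indicator (measurableSet_singleton _)) hdrift
    have hmul := lintegral_mul_eq_lintegral_mul_lintegral_of_indepFun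
      ((measurable_one.indicator (measurableSet_singleton (E r))).comp hH_meas)
      (hdrift.comp (measurable_pi_lambda _ hB_meas)) hind
    rw [lintegral_const_mul _ (by fun_prop), ← lintegral_path_add_drift hB_meas hB T _ hF, ← hPA,
      ← lintegral_indicator_one (hA_meas r), ← lintegral_indicator (hA_meas r)]
    refine Eq.trans (lintegral_congr fun ω => ?_) hmul
    by_cases hω : H ω = E r
    · have : (fun u : Set.Iic T => infoProcess σ H B u ω)
          = fun u : Set.Iic T => B u ω + σ * E r * u := by
        funext u
        rw [infoProcess, hω]
        ring
      simp [hω, this]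
    · simp [hω]
  rw [← setLIntegral_univ, ← setLIntegral_congr hcover, lintegral_iUnion hA_meas hA_disj,
    tsum_fintype, Finset.sum_congr rfl fun r _ => hpiece r, ← lintegral_finsetSum _ (by fun_prop)]
  refine lintegral_congr fun ω => ?_
  rw [mixtureLikelihood, ENNReal.ofReal_sum_of_nonneg fun r _ =>
    mul_nonneg (hp r) (Real.exp_pos _).le, Finset.mul_sum]
  refine Finset.sum_congr rfl fun r _ => ?_
  rw [ENNReal.ofReal_mul (hp r), mul_left_comm]
  congr 5
  ring

end Mixture

/-! ### Change of measure and exact exponential decay -/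

section Decoherence

open scoped ENNReal

variable {D : ℕ} {E p : Fin D → ℝ}

/-- The numerator of the decoherence factor. -/
noncomputable def decoherenceNumerator (σ : ℝ) (E : Fin D → ℝ) (n m : Fin D) (t x : ℝ) : ℝ :=
  Real.exp (1 / 2 * σ * (E n + E m) * x - 1 / 4 * σ ^ 2 * (E n ^ 2 + E m ^ 2) * t)

/-- The rate of decay of the expectation of the decoherence factor. -/
noncomputable def decoherenceRate (σ : ℝ) (E : Fin D → ℝ) (n m : Fin D) : ℝ :=
  1 / 8 * σ ^ 2 * (E n - E m) ^ 2

theorem decoherenceRate_pos {σ : ℝ} (hσ : σ ≠ 0) (hE_inj : Function.Injective E) {n m : Fin D}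
    (hnm : n ≠ m) : 0 < decoherenceRate σ E n m := by
  have : E n - E m ≠ 0 := sub_ne_zero.2 (hE_inj.ne hnm)
  unfold decoherenceRate
  positivity

theorem decoherenceFactor_eq_div (σ : ℝ) (n m : Fin D) (t x : ℝ) :
    decoherenceFactor σ E p n m t x
      = decoherenceNumerator σ E n m t x / mixtureLikelihood σ E p t x := rfl

theorem decoherenceFactor_pos (σ : ℝ) (hp : ∀ r, 0 ≤ p r) (hp_sum : ∑ r, p r = 1) (n m : Fin D)
    (t x : ℝ) : 0 < decoherenceFactor σ E p n m t x :=
  div_pos (Real.exp_pos _) (mixtureLikelihood_pos σ hp hp_sum t x)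

theorem measurable_decoherenceNumerator (σ : ℝ) (n m : Fin D) (t : ℝ) :
    Measurable (decoherenceNumerator σ E n m t) := by
  unfold decoherenceNumerator
  fun_prop

theorem measurable_decoherenceFactor (σ : ℝ) (n m : Fin D) (t : ℝ) :
    Measurable (decoherenceFactor σ E p n m t) :=
  (measurable_decoherenceNumerator σ n m t).div (measurable_mixtureLikelihood σ t)

theorem continuous_decoherenceFactor (σ : ℝ) (hp : ∀ r, 0 ≤ p r) (hp_sum : ∑ r, p r = 1)
    (n m : Fin D) :
    Continuous fun q : ℝ × ℝ => decoherenceFactor σ E p n m q.1 q.2 := by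
  simp only [decoherenceFactor_eq_div]
  refine Continuous.div ?_ ?_ fun q => (mixtureLikelihood_pos σ hp hp_sum q.1 q.2).ne'
  · unfold decoherenceNumerator
    fun_prop
  · unfold mixtureLikelihood
    fun_prop

/-- The rate comes from `(a² + b²)/4 - (a + b)²/8 = (a - b)²/8`. The last factor has mean one when
`w` is a centred Gaussian of variance `h`. -/
theorem decoherenceNumerator_add (σ : ℝ) (n m : Fin D) (s h x w : ℝ) :
    decoherenceNumerator σ E n m (s + h) (x + w)
      = decoherenceNumerator σ E n m s x * (Real.exp (-decoherenceRate σ E n m * h)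
        * Real.exp (1 / 2 * σ * (E n + E m) * w - (1 / 2 * σ * (E n + E m)) ^ 2 * h / 2)) := by
  rw [decoherenceNumerator, decoherenceNumerator, decoherenceRate, ← Real.exp_add, ← Real.exp_add]
  congr 1
  ring

variable {Ω : Type*} [mΩ : MeasurableSpace Ω] {P : Measure Ω}
  {B : ℝ≥0 → Ω → ℝ} {H : Ω → ℝ}

/-- The increment after `s` is independent of the path up to `s`, and its exponential factor
integrates to one. -/
theorem lintegral_indicator_mul_decoherenceNumerator (σ : ℝ) (hB_meas : ∀ t, Measurable (B t))
    (hB : IsPreBrownianReal B P) (n m : Fin D) (s h : ℝ≥0) {S : Set (Set.Iic s → ℝ)}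
    (hS : MeasurableSet S) :
    ∫⁻ ω, S.indicator 1 (fun u => B u ω)
        * ENNReal.ofReal (decoherenceNumerator σ E n m (s + h : ℝ≥0) (B (s + h) ω)) ∂P
      = ENNReal.ofReal (Real.exp (-decoherenceRate σ E n m * h)) *
        ∫⁻ ω, S.indicator 1 (fun u => B u ω)
          * ENNReal.ofReal (decoherenceNumerator σ E n m s (B s ω)) ∂P := by
  set a := 1 / 2 * σ * (E n + E m)
  set f : (Set.Iic s → ℝ) → ℝ≥0∞ := fun x => S.indicator 1 x
    * ENNReal.ofReal (decoherenceNumerator σ E n m s (x ⟨s, Set.self_mem_Iic⟩)) with hf_def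
  set g : ℝ → ℝ≥0∞ := fun w => ENNReal.ofReal (Real.exp (a * w - a ^ 2 * h / 2)) with hg_def
  have hf : Measurable f := (measurable_one.indicator hS).mul
    ((measurable_decoherenceNumerator σ n m s).comp (measurable_pi_apply _)).ennreal_ofReal
  have hg : Measurable g := by fun_prop
  have hind := (hB.indepFun_shift s).symm.comp (φ := f) (ψ := fun x : ℝ≥0 → ℝ => g (x h)) hf
    (hg.comp (measurable_pi_apply h))
  have hpath : Measurable fun ω (u : Set.Iic s) => B u ω :=
    measurable_pi_lambda _ fun u => hB_meas u
  have hinc : Measurable fun ω => B (s + h) ω - B s ω := (hB_meas _).sub (hB_meas _)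
  have hmul := lintegral_mul_eq_lintegral_mul_lintegral_of_indepFun (hf.comp hpath)
    (hg.comp hinc) hind
  have hone : ∫⁻ ω, g (B (s + h) ω - B s ω) ∂P = 1 := by
    rw [← lintegral_map hg hinc, ((hB.shift s).hasLaw_eval h).map_eq]
    exact lintegral_exp_gaussianReal h a
  replace hmul := hmul.trans ((congrArg _ hone).trans (mul_one _))
  refine Eq.trans ?_ (congrArg _ hmul)
  rw [← lintegral_const_mul _ ((hf.comp hpath).mul (hg.comp hinc))]
  refine lintegral_congr fun ω => ?_
  simp only [hf_def, hg_def, Pi.mul_apply, Function.comp_apply]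
  have := decoherenceNumerator_add (E := E) σ n m s h (B s ω) (B (s + h) ω - B s ω)
  rw [add_sub_cancel] at this
  rw [NNReal.coe_add, this,
    ENNReal.ofReal_mul (show 0 ≤ decoherenceNumerator σ E n m s (B s ω) from (Real.exp_pos _).le),
    ENNReal.ofReal_mul (Real.exp_pos _).le]
  ring

variable [IsProbabilityMeasure P] (σ : ℝ) (hB_meas : ∀ t, Measurable (B t)) (hB : IsPreBrownianReal B P)
  (hH_meas : Measurable H) (hE_inj : Function.Injective E)
  (hH_law : ∀ r, P.real {ω | H ω = E r} = p r) (hp_sum : ∑ r, p r = 1)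
  (hHB : IndepFun H (fun ω t => B t ω) P)

include hB_meas hB hH_meas hE_inj hH_law hp_sum hHB in
-- Passing from `infoProcess` to `B` costs the density `mixtureLikelihood`, which is exactly the
-- denominator of the factor.
theorem setLIntegral_decoherenceFactor_path (n m : Fin D) (s h : ℝ≥0) {S : Set (Set.Iic s → ℝ)}
    (hS : MeasurableSet S) :
    ∫⁻ ω in (fun ω (u : Set.Iic s) => infoProcess σ H B u ω) ⁻¹' S,
        ENNReal.ofReal (decoherenceFactor σ E p n m (s + h : ℝ≥0) (infoProcess σ H B (s + h) ω)) ∂P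
      = ∫⁻ ω, S.indicator 1 (fun u => B u ω)
        * ENNReal.ofReal (decoherenceNumerator σ E n m (s + h : ℝ≥0) (B (s + h) ω)) ∂P := by
  have hp : ∀ r, 0 ≤ p r := fun r => hH_law r ▸ measureReal_nonneg
  -- Restriction of paths to `[0, s]`: the event depends on the past of `s`, but the density must be
  -- taken at `s + h`.
  let rs : (Set.Iic (s + h) → ℝ) → Set.Iic s → ℝ :=
    fun x u => x ⟨u, u.2.trans (le_add_of_nonneg_right h.2)⟩
  have hrs : Measurable rs := measurable_pi_lambda _ fun u => measurable_pi_apply _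
  let F : (Set.Iic (s + h) → ℝ) → ℝ≥0∞ := fun x => S.indicator 1 (rs x)
    * ENNReal.ofReal (decoherenceFactor σ E p n m (s + h : ℝ≥0) (x ⟨s + h, Set.self_mem_Iic⟩))
  have hF : Measurable F := ((measurable_one.indicator hS).comp hrs).mul
    ((measurable_decoherenceFactor σ n m _).comp (measurable_pi_apply _)).ennreal_ofReal
  have hpath : Measurable fun ω (u : Set.Iic s) => infoProcess σ H B u ω :=
    measurable_pi_lambda _ fun u => measurable_infoProcess σ hH_meas hB_meas u
  calc _ = ∫⁻ ω, F (fun u => infoProcess σ H B u ω) ∂P := by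
        rw [← lintegral_indicator (hpath hS)]
        refine lintegral_congr fun ω => ?_
        by_cases hω : (fun u : Set.Iic s => infoProcess σ H B u ω) ∈ S
        · simp [F, rs, hω]
        · simp [F, rs, hω]
    _ = _ := by
        rw [lintegral_path_infoProcess σ hB_meas hB hH_meas hE_inj hH_law hp_sum hHB _ hF]
        refine lintegral_congr fun ω => ?_
        have hL := mixtureLikelihood_pos (E := E) σ hp hp_sum (s + h : ℝ≥0) (B (s + h) ω)
        simp only [F, rs]
        rw [mul_assoc, ← ENNReal.ofReal_mul
          (decoherenceFactor_pos (E := E) σ hp hp_sum n m _ _).le, decoherenceFactor_eq_div,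
          div_mul_cancel₀ _ hL.ne']

theorem exists_preimage_of_measurableSet_infoFiltration {s : ℝ≥0} {A : Set Ω}
    (hA : MeasurableSet[infoFiltration σ hH_meas hB_meas s] A) :
    ∃ S : Set (Set.Iic s → ℝ), MeasurableSet S ∧
      (fun ω (u : Set.Iic s) => infoProcess σ H B u ω) ⁻¹' S = A := by
  have hle : infoFiltration σ hH_meas hB_meas s
      ≤ MeasurableSpace.comap (fun ω (u : Set.Iic s) => infoProcess σ H B u ω)
        MeasurableSpace.pi := by
    refine iSup₂_le fun u hu => ?_
    rintro _ ⟨V, hV, rfl⟩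
    exact ⟨(fun x => x ⟨u, hu⟩) ⁻¹' V, measurable_pi_apply _ hV, rfl⟩
  exact hle A hA

include hB hE_inj hH_law hp_sum hHB in
theorem setLIntegral_decoherenceFactor (n m : Fin D) {s T : ℝ≥0} (hsT : s ≤ T) {A : Set Ω}
    (hA : MeasurableSet[infoFiltration σ hH_meas hB_meas s] A) :
    ∫⁻ ω in A, ENNReal.ofReal (decoherenceFactor σ E p n m T (infoProcess σ H B T ω)) ∂P
      = ENNReal.ofReal (Real.exp (-decoherenceRate σ E n m * (T - s)))
        * ∫⁻ ω in A, ENNReal.ofReal (decoherenceFactor σ E p n m s (infoProcess σ H B s ω)) ∂P := by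
  obtain ⟨h, rfl⟩ := exists_add_of_le hsT
  obtain ⟨S, hS, rfl⟩ := exists_preimage_of_measurableSet_infoFiltration σ hB_meas hH_meas hA
  -- The case `h = 0` translates the integral at time `s` to the Brownian side too.
  have h0 := setLIntegral_decoherenceFactor_path σ hB_meas hB hH_meas hE_inj hH_law hp_sum hHB
    n m s 0 hS
  rw [add_zero] at h0
  rw [h0, setLIntegral_decoherenceFactor_path σ hB_meas hB hH_meas hE_inj hH_law hp_sum hHB
    n m s h hS, lintegral_indicator_mul_decoherenceNumerator σ hB_meas hB n m s h hS,
    NNReal.coe_add, add_sub_cancel_left]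

include hB_meas hB hH_meas hE_inj hH_law hp_sum hHB in
theorem lintegral_decoherenceFactor (n m : Fin D) (T : ℝ≥0) :
    ∫⁻ ω, ENNReal.ofReal (decoherenceFactor σ E p n m T (infoProcess σ H B T ω)) ∂P
      = ENNReal.ofReal (Real.exp (-decoherenceRate σ E n m * T)) := by
  have h := setLIntegral_decoherenceFactor σ hB_meas hB hH_meas hE_inj hH_law hp_sum hHB n m
    (zero_le : 0 ≤ T) (A := Set.univ) MeasurableSet.univ
  have h0 : ∫⁻ ω, ENNReal.ofReal (decoherenceFactor σ E p n m (0 : ℝ≥0)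
      (infoProcess σ H B 0 ω)) ∂P = 1 := by
    rw [lintegral_congr_ae (g := fun _ => 1), lintegral_one, measure_univ]
    filter_upwards [hB.eval_zero_ae_eq_zero] with ω hω
    simp [infoProcess, hω, decoherenceFactor, hp_sum]
  rwa [setLIntegral_univ, setLIntegral_univ, h0, mul_one, NNReal.coe_zero, sub_zero] at h

end Decoherence

/-! ### The usual augmentation -/

section Augmentation

variable {Ω : Type*} [mΩ : MeasurableSpace Ω] {P : Measure Ω}

/-- The sets a.e. equal to a member of `𝓕 u` form a σ-algebra containing `𝓕 u` and the null events.
The strict `s < u` absorbs the right-continuous version. -/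
theorem exists_ae_eq_of_measurableSet_usualAugmentation {𝓕 : Filtration ℝ≥0 mΩ} {s u : ℝ≥0}
    (hsu : s < u) {A : Set Ω} (hA : MeasurableSet[usualAugmentation 𝓕 P s] A) :
    ∃ A', MeasurableSet[𝓕 u] A' ∧ A =ᵐ[P] A' := by
  have hle : 𝓕 u ⊔ MeasurableSpace.generateFrom {A | MeasurableSet A ∧ P A = 0}
      ≤ eventuallyMeasurableSpace (𝓕 u) (ae P) := by
    refine sup_le (fun A hA => ⟨A, hA, EventuallyEq.rfl⟩)
      (MeasurableSpace.generateFrom_le fun A hA => ⟨∅, @MeasurableSet.empty _ (𝓕 u), ?_⟩)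
    exact ae_eq_empty.2 hA.2
  rw [usualAugmentation, Filtration.rightCont_eq] at hA
  exact hle A (iInf₂_le (α := MeasurableSpace Ω) u hsu A hA)

theorem IsPotential.const_mul {X : ℝ≥0 → Ω → ℝ} {𝔽 : Filtration ℝ≥0 mΩ}
    (hX : IsPotential X 𝔽 P) {c : ℝ} (hc : 0 < c) :
    IsPotential (fun t ω => c * X t ω) 𝔽 P where
  pos := hX.pos.mono fun ω hω t => mul_pos hc (hω t)
  rightCts := hX.rightCts.mono fun ω hω t => (hω t).const_mul c
  supermartingale := hX.supermartingale.smul_nonneg hc.le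
  tendsto_expectation := by
    simpa [integral_const_mul] using hX.tendsto_expectation.const_mul c

end Augmentation

/-! ### The potential property -/

section Potential

open scoped ENNReal

variable {D : ℕ} {E p : Fin D → ℝ} {Ω : Type*} [mΩ : MeasurableSpace Ω] {P : Measure Ω}
  {B : ℝ≥0 → Ω → ℝ} {H : Ω → ℝ}
  (σ : ℝ) (hB_meas : ∀ t, Measurable (B t)) (hB : IsBrownianReal B P)
  (hH_meas : Measurable H) (hE_inj : Function.Injective E)
  (hH_law : ∀ r, P.real {ω | H ω = E r} = p r) (hp_sum : ∑ r, p r = 1)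
  (hHB : IndepFun H (fun ω t => B t ω) P)

include hB hH_law hp_sum in
theorem ae_continuous_decoherenceFactor (n m : Fin D) :
    ∀ᵐ ω ∂P, Continuous fun t : ℝ≥0 =>
      decoherenceFactor σ E p n m t (infoProcess σ H B t ω) := by
  have hp : ∀ r, 0 ≤ p r := fun r => hH_law r ▸ measureReal_nonneg
  filter_upwards [hB.cont] with ω hω
  refine (continuous_decoherenceFactor σ hp hp_sum n m).comp
    (f := fun t : ℝ≥0 => ((t : ℝ), infoProcess σ H B t ω)) ?_
  unfold infoProcess
  fun_prop

variable [IsProbabilityMeasure P]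

include hB hE_inj hH_law hp_sum hHB in
-- The inequality holds with any `u` in `(s, T]` in place of `s`. As `u` decreases to `s`, Fatou on
-- `A` would bound the wrong way. It is applied on `Aᶜ` instead, and the known total mass,
-- continuous in `u`, converts the result into a bound on `A`.
theorem setLIntegral_decoherenceFactor_le (n m : Fin D) {s T : ℝ≥0} (hsT : s ≤ T) {A : Set Ω}
    (hA : MeasurableSet[usualAugmentation (infoFiltration σ hH_meas hB_meas) P s] A) :
    ∫⁻ ω in A, ENNReal.ofReal (decoherenceFactor σ E p n m T (infoProcess σ H B T ω)) ∂P
      ≤ ∫⁻ ω in A, ENNReal.ofReal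
          (decoherenceFactor σ E p n m s (infoProcess σ H B s ω)) ∂P := by
  rcases hsT.eq_or_lt with rfl | hsT
  · rfl
  have hAm : MeasurableSet A := (usualAugmentation _ P).le s A hA
  set f : ℝ≥0 → Ω → ℝ≥0∞ := fun u ω =>
    ENNReal.ofReal (decoherenceFactor σ E p n m u (infoProcess σ H B u ω)) with hf_def
  have hf_meas : ∀ u, Measurable (f u) := fun u =>
    ((measurable_decoherenceFactor σ n m u).comp
      (measurable_infoProcess σ hH_meas hB_meas u)).ennreal_ofReal
  have htotal : ∀ u, ∫⁻ ω, f u ω ∂P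
      = ENNReal.ofReal (Real.exp (-decoherenceRate σ E n m * u)) := fun u =>
    lintegral_decoherenceFactor σ hB_meas hB.toIsPreBrownianReal hH_meas hE_inj hH_law hp_sum
      hHB n m u
  have hrate : 0 ≤ decoherenceRate σ E n m := by
    unfold decoherenceRate
    positivity
  have hdecay : ∀ u, s < u → u ≤ T → ∫⁻ ω in A, f T ω ∂P ≤ ∫⁻ ω in A, f u ω ∂P := by
    intro u hsu huT
    obtain ⟨A', hA', hAA'⟩ := exists_ae_eq_of_measurableSet_usualAugmentation hsu hA
    rw [setLIntegral_congr hAA', setLIntegral_congr hAA',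
      setLIntegral_decoherenceFactor σ hB_meas hB.toIsPreBrownianReal hH_meas hE_inj hH_law
        hp_sum hHB n m huT hA']
    refine mul_le_of_le_one_left (zero_le) (ENNReal.ofReal_le_one.2 (Real.exp_le_one_iff.2 ?_))
    have : (u : ℝ) ≤ T := huT
    nlinarith
  have hfatou : ∫⁻ ω in Aᶜ, f s ω ∂P ≤ liminf (fun u => ∫⁻ ω in Aᶜ, f u ω ∂P) (𝓝[>] s) := by
    refine le_trans (lintegral_mono_ae ?_) (lintegral_liminf_le hf_meas)
    filter_upwards [ae_restrict_of_ae
      (ae_continuous_decoherenceFactor (E := E) σ hB hH_law hp_sum n m)] with ω hω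
    exact (((ENNReal.continuous_ofReal.comp hω).tendsto s).mono_left
      nhdsWithin_le_nhds).liminf_eq.ge
  have hbound : ∀ᶠ u in 𝓝[>] s, ∫⁻ ω in Aᶜ, f u ω ∂P
      ≤ ENNReal.ofReal (Real.exp (-decoherenceRate σ E n m * u)) - ∫⁻ ω in A, f T ω ∂P := by
    filter_upwards [Ioc_mem_nhdsGT hsT] with u hu
    rw [← htotal u, ← lintegral_add_compl (μ := P) (f u) hAm]
    refine ENNReal.le_sub_of_add_le_left ?_ (add_le_add_left (hdecay u hu.1 hu.2) _)
    exact ((setLIntegral_le_lintegral _ _).trans_lt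
      ((htotal T).trans_lt ENNReal.ofReal_lt_top)).ne
  have hlim : Tendsto (fun u : ℝ≥0 => ENNReal.ofReal (Real.exp (-decoherenceRate σ E n m * u))
      - ∫⁻ ω in A, f T ω ∂P) (𝓝[>] s)
      (𝓝 (ENNReal.ofReal (Real.exp (-decoherenceRate σ E n m * s)) - ∫⁻ ω in A, f T ω ∂P)) := by
    have hc : Continuous fun u : ℝ≥0 =>
        ENNReal.ofReal (Real.exp (-decoherenceRate σ E n m * u)) :=
      ENNReal.continuous_ofReal.comp (by fun_prop)
    exact ENNReal.Tendsto.sub ((hc.tendsto s).mono_left nhdsWithin_le_nhds) tendsto_const_nhds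
      (Or.inl ENNReal.ofReal_ne_top)
  have hcompl := hfatou.trans ((liminf_le_liminf hbound).trans hlim.liminf_eq.le)
  -- Subtraction in `ℝ≥0∞` is truncated, so undoing it needs this bound.
  have hT_le : ∫⁻ ω in A, f T ω ∂P ≤ ENNReal.ofReal (Real.exp (-decoherenceRate σ E n m * s)) := by
    refine (setLIntegral_le_lintegral _ _).trans ?_
    rw [htotal]
    refine ENNReal.ofReal_le_ofReal (Real.exp_le_exp.2 ?_)
    have : (s : ℝ) ≤ T := hsT.le
    nlinarith
  have hsum := add_le_of_le_tsub_left_of_le hT_le hcompl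
  rw [← htotal s, ← lintegral_add_compl (μ := P) (f s) hAm] at hsum
  refine (ENNReal.add_le_add_iff_right ?_).1 hsum
  exact ((setLIntegral_le_lintegral _ _).trans_lt
    ((htotal s).trans_lt ENNReal.ofReal_lt_top)).ne

include hB_meas hB hH_meas hE_inj hH_law hp_sum hHB

theorem integrable_decoherenceFactor (n m : Fin D) (t : ℝ≥0) :
    Integrable (fun ω => decoherenceFactor σ E p n m t (infoProcess σ H B t ω)) P := by
  have hp : ∀ r, 0 ≤ p r := fun r => hH_law r ▸ measureReal_nonneg
  refine (lintegral_ofReal_ne_top_iff_integrable ?_ ?_).1 ?_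
  · exact ((measurable_decoherenceFactor σ n m t).comp
      (measurable_infoProcess σ hH_meas hB_meas t)).aestronglyMeasurable
  · exact ae_of_all _ fun ω => (decoherenceFactor_pos σ hp hp_sum n m _ _).le
  · rw [lintegral_decoherenceFactor σ hB_meas hB.toIsPreBrownianReal hH_meas hE_inj hH_law hp_sum
      hHB]
    exact ENNReal.ofReal_ne_top

theorem integral_decoherenceFactor (n m : Fin D) (t : ℝ≥0) :
    ∫ ω, decoherenceFactor σ E p n m t (infoProcess σ H B t ω) ∂P
      = Real.exp (-decoherenceRate σ E n m * t) := by
  have hp : ∀ r, 0 ≤ p r := fun r => hH_law r ▸ measureReal_nonneg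
  rw [integral_eq_lintegral_of_nonneg_ae
      (ae_of_all _ fun ω => (decoherenceFactor_pos σ hp hp_sum n m _ _).le)
      (integrable_decoherenceFactor σ hB_meas hB hH_meas hE_inj hH_law hp_sum hHB n m
        t).aestronglyMeasurable,
    lintegral_decoherenceFactor σ hB_meas hB.toIsPreBrownianReal hH_meas hE_inj hH_law hp_sum hHB,
    ENNReal.toReal_ofReal (Real.exp_pos _).le]

/-- The lower bound on `𝔽` gives adaptedness, the upper bound the inequality on its events. -/
theorem supermartingale_decoherenceFactor {𝔽 : Filtration ℝ≥0 mΩ}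
    (h𝔽_ge : infoFiltration σ hH_meas hB_meas ≤ 𝔽)
    (h𝔽_le : 𝔽 ≤ usualAugmentation (infoFiltration σ hH_meas hB_meas) P) (n m : Fin D) :
    Supermartingale
      (fun t : ℝ≥0 => fun ω => decoherenceFactor σ E p n m t (infoProcess σ H B t ω)) 𝔽 P := by
  have hp : ∀ r, 0 ≤ p r := fun r => hH_law r ▸ measureReal_nonneg
  have hint := integrable_decoherenceFactor σ hB_meas hB hH_meas hE_inj hH_law hp_sum hHB n m
  have hadp : StronglyAdapted 𝔽 (fun t : ℝ≥0 => fun ω =>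
      decoherenceFactor σ E p n m t (infoProcess σ H B t ω)) := by
    intro t
    have hξ : Measurable[𝔽 t] (infoProcess σ H B t) :=
      ((Filtration.stronglyAdapted_natural fun t =>
        (measurable_infoProcess σ hH_meas hB_meas t).stronglyMeasurable) t).measurable.mono
          (h𝔽_ge t) le_rfl
    exact ((measurable_decoherenceFactor σ n m t).comp hξ).stronglyMeasurable
  have hsetInt : ∀ (t : ℝ≥0) (A : Set Ω),
      ∫ ω in A, decoherenceFactor σ E p n m t (infoProcess σ H B t ω) ∂P
        = (∫⁻ ω in A, ENNReal.ofReal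
            (decoherenceFactor σ E p n m t (infoProcess σ H B t ω)) ∂P).toReal := fun t A =>
    integral_eq_lintegral_of_nonneg_ae
      (ae_of_all _ fun ω => (decoherenceFactor_pos σ hp hp_sum n m _ _).le)
      (hint t).aestronglyMeasurable.restrict
  have hsub := submartingale_of_setIntegral_le (μ := P) hadp.neg (fun t => (hint t).neg)
    fun s t hst A hA => by
      simp only [Pi.neg_apply, integral_neg]
      rw [hsetInt, hsetInt, neg_le_neg_iff]
      refine ENNReal.toReal_mono ?_ (setLIntegral_decoherenceFactor_le σ hB_meas hB hH_meas hE_inj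
        hH_law hp_sum hHB n m hst (h𝔽_le s A hA))
      refine ((setLIntegral_le_lintegral _ _).trans_lt ?_).ne
      rw [lintegral_decoherenceFactor σ hB_meas hB.toIsPreBrownianReal hH_meas hE_inj hH_law
        hp_sum hHB]
      exact ENNReal.ofReal_lt_top
  simpa using hsub.neg

theorem isPotential_decoherenceFactor (hσ : σ ≠ 0) {𝔽 : Filtration ℝ≥0 mΩ}
    (h𝔽_ge : infoFiltration σ hH_meas hB_meas ≤ 𝔽)
    (h𝔽_le : 𝔽 ≤ usualAugmentation (infoFiltration σ hH_meas hB_meas) P) {n m : Fin D}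
    (hnm : n ≠ m) :
    IsPotential
      (fun t : ℝ≥0 => fun ω => decoherenceFactor σ E p n m t (infoProcess σ H B t ω)) 𝔽 P where
  pos := ae_of_all _ fun ω t =>
    decoherenceFactor_pos σ (fun r => hH_law r ▸ measureReal_nonneg) hp_sum n m _ _
  rightCts := (ae_continuous_decoherenceFactor σ hB hH_law hp_sum n m).mono
    fun ω hω t => hω.continuousWithinAt
  supermartingale := supermartingale_decoherenceFactor σ hB_meas hB hH_meas hE_inj hH_law hp_sum
    hHB h𝔽_ge h𝔽_le n m
  tendsto_expectation := by
    simp only [integral_decoherenceFactor σ hB_meas hB hH_meas hE_inj hH_law hp_sum hHB]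
    have hk := decoherenceRate_pos hσ hE_inj hnm
    refine Real.tendsto_exp_atBot.comp ?_
    exact (NNReal.tendsto_coe_atTop.2 tendsto_id).const_mul_atTop_of_neg (neg_lt_zero.2 hk)

end Potential

end EnergyReduction

theorem mainTheorem7
    -- a finite-dimensional Hilbert space, a Hamiltonian and an initial density matrix
    {𝓗 : Type*} [NormedAddCommGroup 𝓗] [InnerProductSpace ℂ 𝓗] [FiniteDimensional ℂ 𝓗]
    [CompleteSpace 𝓗]
    (hbar σ : ℝ) (hhbar : 0 < hbar) (hσ : σ ≠ 0)
    (Hhat ρ₀ : 𝓗 →L[ℂ] 𝓗) (hHhat : IsSelfAdjoint Hhat)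
    (hρ₀ : ρ₀.IsPositive) (hρ₀_tr : EnergyReduction.tr ρ₀ = 1)
    -- the distinct energy levels
    {D : ℕ} (E : Fin D → ℝ) (hE_inj : Function.Injective E)
    (hE_spec : ∀ z : ℂ,
      Module.End.HasEigenvalue (Hhat : 𝓗 →ₗ[ℂ] 𝓗) z ↔ ∃ r, z = (E r : ℂ))
    -- a Brownian motion and an independent signal with the Born distribution
    {Ω : Type*} [mΩ : MeasurableSpace Ω] (P : Measure Ω) [IsProbabilityMeasure P]
    (B : ℝ≥0 → Ω → ℝ) (hB_meas : ∀ t, Measurable (B t)) (hB : IsBrownianReal B P)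
    (H : Ω → ℝ) (hH_meas : Measurable H)
    (hH_law : ∀ r, P.real {ω | H ω = E r} =
      (EnergyReduction.tr (ρ₀ * EnergyReduction.energyProj Hhat (E r))).re)
    (hHB : IndepFun H (fun ω t => B t ω) P)
    -- the filtration generated by the information process, possibly augmented
    (𝔽 : Filtration ℝ≥0 mΩ)
    (h𝔽_ge : EnergyReduction.infoFiltration σ hH_meas hB_meas ≤ 𝔽)
    (h𝔽_le : 𝔽 ≤ EnergyReduction.usualAugmentation
      (EnergyReduction.infoFiltration σ hH_meas hB_meas) P)
    (n m : Fin D) (hnm : n ≠ m) :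
    let ξ : ℝ≥0 → Ω → ℝ := EnergyReduction.infoProcess σ H B
    let Pr : Fin D → (𝓗 →L[ℂ] 𝓗) := fun r => EnergyReduction.energyProj Hhat (E r)
    let p : Fin D → ℝ := fun r => (EnergyReduction.tr (ρ₀ * Pr r)).re
    let R : ℝ≥0 → Ω → (𝓗 →L[ℂ] 𝓗) := fun t ω =>
      Pr n * EnergyReduction.stateAt hbar σ Hhat ρ₀ t (ξ t ω) * Pr m
    let Φ : ℝ≥0 → Ω → ℝ := fun t ω => EnergyReduction.decoherenceFactor σ E p n m t (ξ t ω)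
    -- a non-vanishing off-diagonal block has a norm which is a potential
    (Pr n * ρ₀ * Pr m ≠ 0 →
      EnergyReduction.IsPotential (fun t ω => EnergyReduction.hsNorm (R t ω)) 𝔽 P) ∧
    -- the norm of the block is a constant multiple of `Φ`
    (∀ t ω, EnergyReduction.hsNorm (R t ω)
      = EnergyReduction.hsNorm (Pr n * ρ₀ * Pr m) * Φ t ω) ∧
    -- `Φ` itself is a potential, with exponentially decaying expectation
    EnergyReduction.IsPotential Φ 𝔽 P ∧
    (∀ t : ℝ≥0, ∫ ω, Φ t ω ∂P = Real.exp (-(1 / 8) * σ ^ 2 * (E n - E m) ^ 2 * t)) ∧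
    (∀ t : ℝ≥0, ∫ ω, EnergyReduction.hsNorm (R t ω) ∂P
      = EnergyReduction.hsNorm (Pr n * ρ₀ * Pr m)
        * Real.exp (-(1 / 8) * σ ^ 2 * (E n - E m) ^ 2 * t)) := by
  intro ξ Pr p R Φ
  have hρ₀' : IsSelfAdjoint ρ₀ := hρ₀.isSelfAdjoint
  have hsum := EnergyReduction.sum_energyProj hHhat hE_inj hE_spec
  have hp_sum : ∑ r, p r = 1 := EnergyReduction.sum_tr_mul_energyProj hρ₀_tr hsum
  -- Nonnegativity is read off from the `p r` being probabilities.
  have hp : ∀ r, 0 ≤ p r := fun r => measureReal_nonneg.trans_eq (hH_law r)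
  have hnorm : ∀ t ω, EnergyReduction.hsNorm (R t ω)
      = EnergyReduction.hsNorm (Pr n * ρ₀ * Pr m) * Φ t ω := fun t ω =>
    EnergyReduction.hsNorm_energyProj_mul_stateAt_mul_energyProj hHhat hρ₀' hsum hbar σ n m t _
      (EnergyReduction.mixtureLikelihood_pos σ hp hp_sum _ _)
  have hpot : EnergyReduction.IsPotential Φ 𝔽 P :=
    EnergyReduction.isPotential_decoherenceFactor σ hB_meas hB hH_meas hE_inj hH_law hp_sum hHB hσ
      h𝔽_ge h𝔽_le hnm
  have hint : ∀ t : ℝ≥0, ∫ ω, Φ t ω ∂P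
      = Real.exp (-(1 / 8) * σ ^ 2 * (E n - E m) ^ 2 * t) := fun t => by
    refine (EnergyReduction.integral_decoherenceFactor σ hB_meas hB hH_meas hE_inj hH_law hp_sum
      hHB n m t).trans ?_
    rw [EnergyReduction.decoherenceRate]
    congr 1
    ring
  refine ⟨fun hne => ?_, hnorm, hpot, hint, fun t => ?_⟩
  · simp only [hnorm]
    exact hpot.const_mul (EnergyReduction.hsNorm_pos hne)
  · simp only [hnorm]
    rw [integral_const_mul, hint]
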